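/- Let $n\ge 0$ and let $S_n$ be the group of permutations of $\{1,\dots,n\}$. The Schubert polynomials $\mathfrak S_w\in\mathbb Z[x_1,\dots,x_n]$, $w\in S_n$, are defined recursively by $\mathfrak S_{w_0}=x_1^{n-1}x_2^{n-2}\cdots x_{n-1}$ for the longest permutation $w_0=n\,(n-1)\cdots 1$, and, for every $w\ne w_0$, by $\mathfrak S_w=\partial_i\mathfrak S_{ws_i}$, where $i$ is any position with $w(i)<w(i+1)$, $s_i=(i,i+1)$, and $\partial_i f=\dfrac{f-s_if}{x_i-x_{i+1}}$ with $s_i$ acting on polynomials by exchanging $x_i$ and $x_{i+1}$ (the result does not depend on the choice of $i$). Put $\nu_w=\mathfrak S_w(1,1,\dots,1)$ and $$\eta_w=\#\{(i,j,k): i<j<k \text{ and } w(i)<w(k)<w(j)\},$$ the number of occurrences of the pattern $132$ in $w$. Then, for every $w\in S_n$, $\nu_w=2$ if and only if $\eta_w=1$. -/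

import Mathlib

open MvPolynomial

namespace SchubertPoly

/-- The action of the transposition `(a b)` on polynomials by exchanging `x_a` and `x_b`. -/
noncomputable def swapVars {n : ℕ} (a b : Fin n) (f : MvPolynomial (Fin n) ℤ) :
    MvPolynomial (Fin n) ℤ :=
  rename (Equiv.swap a b) f

theorem sub_dvd_sub_swapVars {n : ℕ} (a b : Fin n) (f : MvPolynomial (Fin n) ℤ) :
    (X a - X b : MvPolynomial (Fin n) ℤ) ∣ f - swapVars a b f := by
  unfold swapVars
  induction f using MvPolynomial.induction_on with
  | C r => simp
  | add p q hp hq =>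
    have h := dvd_add hp hq
    rw [map_add]
    convert h using 1
    ring
  | mul_X p k hp =>
    have h1 : (X a - X b : MvPolynomial (Fin n) ℤ) ∣ X k - X (Equiv.swap a b k) := by
      by_cases ha : k = a
      · subst ha; simp
      · by_cases hb : k = b
        · subst hb
          rw [Equiv.swap_apply_right]
          exact ⟨-1, by ring⟩
        · rw [Equiv.swap_apply_of_ne_of_ne ha hb]; simp
    rw [map_mul, rename_X]
    have h := dvd_add (dvd_mul_of_dvd_left hp (X k))
      (dvd_mul_of_dvd_right h1 (rename (Equiv.swap a b) p))
    convert h using 1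
    ring

/-- The divided difference `(f - s f) / (x_a - x_b)`, where `s` exchanges `x_a` and `x_b`.
It is only used for `a ≠ b`, where the quotient is unique. -/
noncomputable def dividedDiff {n : ℕ} (a b : Fin n) (f : MvPolynomial (Fin n) ℤ) :
    MvPolynomial (Fin n) ℤ :=
  (sub_dvd_sub_swapVars a b f).choose

theorem mul_dividedDiff {n : ℕ} (a b : Fin n) (f : MvPolynomial (Fin n) ℤ) :
    (X a - X b) * dividedDiff a b f = f - swapVars a b f :=
  (sub_dvd_sub_swapVars a b f).choose_spec.symm

/-- Number of pairs of positions `i < j` with `w i < w j` (used for termination only). -/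
def nonInversions {n : ℕ} (w : Equiv.Perm (Fin n)) : ℕ :=
  (Finset.univ.filter fun p : Fin n × Fin n => p.1 < p.2 ∧ w p.1 < w p.2).card

theorem nonInversions_mul_swap_lt {n : ℕ} (w : Equiv.Perm (Fin n)) (a b : Fin n)
    (hab : a.val + 1 = b.val) (hw : w a < w b) :
    nonInversions (w * Equiv.swap a b) < nonInversions w := by
  unfold nonInversions
  have hinj : Function.Injective
      (fun p : Fin n × Fin n => (Equiv.swap a b p.1, Equiv.swap a b p.2)) := by
    rintro ⟨p, q⟩ ⟨r, s⟩ h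
    simpa using h
  rw [← Finset.card_image_of_injective _ hinj]
  apply Finset.card_lt_card
  rw [Finset.ssubset_iff_of_subset]
  · refine ⟨(a, b), ?_, ?_⟩
    · simp only [Finset.mem_filter, Finset.mem_univ, true_and]
      exact ⟨by rw [Fin.lt_def]; omega, hw⟩
    · simp only [Finset.mem_image, Finset.mem_filter, Finset.mem_univ, true_and, Prod.mk.injEq,
        not_exists, not_and]
      rintro ⟨u, v⟩ ⟨huv, -⟩ h1 h2
      have hu : u = b := by rw [← Equiv.swap_apply_left a b]; exact
        (Equiv.swap_apply_eq_iff.mp h1).trans (by simp)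
      have hv : v = a := by rw [← Equiv.swap_apply_right a b]; exact
        (Equiv.swap_apply_eq_iff.mp h2).trans (by simp)
      subst hu hv
      simp only [Fin.lt_def] at huv
      omega
  · intro p hp
    rw [Finset.mem_image] at hp
    obtain ⟨⟨u, v⟩, huw, rfl⟩ := hp
    obtain ⟨huv, hwuv⟩ := (Finset.mem_filter.mp huw).2
    simp only [Finset.mem_filter, Finset.mem_univ, true_and]
    refine ⟨?_, hwuv⟩
    simp only [Equiv.Perm.mul_apply] at huv hwuv
    have hne : ¬ (u = a ∧ v = b) := by
      rintro ⟨rfl, rfl⟩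
      rw [Equiv.swap_apply_left, Equiv.swap_apply_right] at hwuv
      exact lt_asymm hw hwuv
    rw [Equiv.swap_apply_def, Equiv.swap_apply_def]
    simp only [Fin.lt_def, Fin.ext_iff] at *
    split_ifs <;> omega

theorem exists_ascent {n : ℕ} (w : Equiv.Perm (Fin n)) (hw : w ≠ Fin.revPerm) :
    ∃ p : Fin n × Fin n, p.1.val + 1 = p.2.val ∧ w p.1 < w p.2 := by
  by_contra! h
  apply hw
  cases n with
  | zero => exact Subsingleton.elim _ _
  | succ m =>
    have hmono : StrictMono (fun i => Fin.rev (w i)) := by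
      rw [Fin.strictMono_iff_lt_succ]
      intro i
      rw [Fin.rev_lt_rev]
      refine lt_of_le_of_ne (h (i.castSucc, i.succ) (by simp)) ?_
      intro he
      have := w.injective he
      simp [Fin.ext_iff] at this
    have hid : (fun i => Fin.rev (w i)) = id := by
      rw [← StrictMono.range_inj hmono strictMono_id, Set.range_id, Set.range_eq_univ]
      intro y
      exact ⟨w.symm (Fin.rev y), by simp⟩
    ext1 i
    have := congrFun hid i
    simp only [id] at this
    rw [Fin.revPerm_apply, ← Fin.rev_rev (w i), this]

open Classical in
/-- The Schubert polynomial of `w ∈ S_n` in the variables `x_1, …, x_n` (the `i`-th variable is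
`X i` with `i : Fin n` counted from `0`): it is `x_1^(n-1) x_2^(n-2) ⋯ x_(n-1)` for the longest
permutation, and for every other `w` it is `∂_i` of the Schubert polynomial of `w s_i`, where `i`
is some position with `w(i) < w(i+1)`. See `schubert_eq_dividedDiff` for the independence of the
chosen position. -/
noncomputable def schubert {n : ℕ} (w : Equiv.Perm (Fin n)) : MvPolynomial (Fin n) ℤ :=
  if hw : w = Fin.revPerm then ∏ i : Fin n, X i ^ (n - 1 - i.val)
  else
    dividedDiff (exists_ascent w hw).choose.1 (exists_ascent w hw).choose.2
      (schubert (w * Equiv.swap (exists_ascent w hw).choose.1 (exists_ascent w hw).choose.2))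
termination_by nonInversions w
decreasing_by
  exact nonInversions_mul_swap_lt w _ _ (exists_ascent w hw).choose_spec.1
    (exists_ascent w hw).choose_spec.2

theorem schubert_revPerm (n : ℕ) :
    schubert (Fin.revPerm : Equiv.Perm (Fin n)) = ∏ i : Fin n, X i ^ (n - 1 - i.val) := by
  rw [schubert]
  simp

theorem X_sub_X_ne_zero {n : ℕ} {a b : Fin n} (h : a ≠ b) :
    (X a - X b : MvPolynomial (Fin n) ℤ) ≠ 0 := by
  rw [sub_ne_zero]
  exact fun he => h (X_injective he)

theorem swapVars_mul {n : ℕ} (a b : Fin n) (f g : MvPolynomial (Fin n) ℤ) :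
    swapVars a b (f * g) = swapVars a b f * swapVars a b g := by
  simp [swapVars]

theorem swapVars_sub {n : ℕ} (a b : Fin n) (f g : MvPolynomial (Fin n) ℤ) :
    swapVars a b (f - g) = swapVars a b f - swapVars a b g := by
  simp [swapVars]

theorem swapVars_X {n : ℕ} (a b k : Fin n) :
    swapVars a b (X k) = X (Equiv.swap a b k) := by
  simp [swapVars]

theorem swapVars_swapVars {n : ℕ} (a b : Fin n) (f : MvPolynomial (Fin n) ℤ) :
    swapVars a b (swapVars a b f) = f := by
  have h : (⇑(Equiv.swap a b) ∘ ⇑(Equiv.swap a b)) = id := by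
    funext x; simp
  simp [swapVars, rename_rename, h]

theorem swapVars_dividedDiff {n : ℕ} {a b : Fin n} (hab : a ≠ b)
    (f : MvPolynomial (Fin n) ℤ) :
    swapVars a b (dividedDiff a b f) = dividedDiff a b f := by
  have h := mul_dividedDiff a b f
  have h2 := congrArg (swapVars a b) h
  simp only [swapVars_mul, swapVars_sub, swapVars_X, Equiv.swap_apply_left,
    Equiv.swap_apply_right, swapVars_swapVars] at h2
  apply mul_left_cancel₀ (X_sub_X_ne_zero hab)
  linear_combination -h2 - h

theorem dividedDiff_comm {n : ℕ} {a b c d : Fin n} (hab : a ≠ b) (hcd : c ≠ d)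
    (hac : a ≠ c) (had : a ≠ d) (hbc : b ≠ c) (hbd : b ≠ d) (f : MvPolynomial (Fin n) ℤ) :
    dividedDiff a b (dividedDiff c d f) = dividedDiff c d (dividedDiff a b f) := by
  have e1 := mul_dividedDiff a b f
  have e2 := mul_dividedDiff c d f
  have e3 := mul_dividedDiff a b (dividedDiff c d f)
  have e4 := mul_dividedDiff c d (dividedDiff a b f)
  have e5 := congrArg (swapVars c d) e1
  have e6 := congrArg (swapVars a b) e2
  have hc : swapVars c d (swapVars a b f) = swapVars a b (swapVars c d f) := by
    simp only [swapVars, rename_rename]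
    congr 2
    funext x
    simp only [Function.comp]
    simp only [Equiv.swap_apply_def]
    grind
  simp only [swapVars_mul, swapVars_sub, swapVars_X, Equiv.swap_apply_of_ne_of_ne hac had,
    Equiv.swap_apply_of_ne_of_ne hbc hbd, Equiv.swap_apply_of_ne_of_ne hac.symm hbc.symm,
    Equiv.swap_apply_of_ne_of_ne had.symm hbd.symm] at e5 e6
  apply mul_left_cancel₀ (X_sub_X_ne_zero hab)
  apply mul_left_cancel₀ (X_sub_X_ne_zero hcd)
  linear_combination (X c - X d) * e3 - (X a - X b) * e4 + e2 - e6 - e1 + e5 - hc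

theorem dividedDiff_braid {n : ℕ} {a b c : Fin n} (hab : a ≠ b) (hbc : b ≠ c) (hac : a ≠ c)
    (f : MvPolynomial (Fin n) ℤ) :
    dividedDiff a b (dividedDiff b c (dividedDiff a b f)) =
      dividedDiff b c (dividedDiff a b (dividedDiff b c f)) := by
  have sc : Equiv.swap a b c = c := Equiv.swap_apply_of_ne_of_ne hac.symm hbc.symm
  have ta : Equiv.swap b c a = a := Equiv.swap_apply_of_ne_of_ne hab hac
  have hsts : swapVars a b (swapVars b c (swapVars a b f)) =
      swapVars b c (swapVars a b (swapVars b c f)) := by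
    simp only [swapVars, rename_rename]
    congr 2
    funext x
    simp only [Function.comp]
    simp only [Equiv.swap_apply_def]
    grind
  have sg := swapVars_dividedDiff hab f
  have sg' := swapVars_dividedDiff hbc f
  have e1 := mul_dividedDiff a b f
  have e1' := mul_dividedDiff b c f
  set g := dividedDiff a b f
  set g' := dividedDiff b c f
  have e2 := mul_dividedDiff b c g
  have e2' := mul_dividedDiff a b g'
  set h := dividedDiff b c g
  set h' := dividedDiff a b g'
  have e3 := mul_dividedDiff a b h
  have e3' := mul_dividedDiff b c h'
  set k := dividedDiff a b h
  set k' := dividedDiff b c h'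
  have e4 := congrArg (swapVars a b) e2
  have e4' := congrArg (swapVars b c) e2'
  have e5 := congrArg (swapVars b c) e1
  have e5' := congrArg (swapVars a b) e1'
  have e6 := congrArg (swapVars a b) e5
  have e6' := congrArg (swapVars b c) e5'
  simp only [swapVars_mul, swapVars_sub, swapVars_X, Equiv.swap_apply_left,
    Equiv.swap_apply_right, sc, ta, sg, sg'] at e4 e4' e5 e5' e6 e6'
  apply mul_left_cancel₀ (X_sub_X_ne_zero hab)
  apply mul_left_cancel₀ (X_sub_X_ne_zero hbc)
  apply mul_left_cancel₀ (X_sub_X_ne_zero hac)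
  linear_combination (X a - X c) * (X b - X c) * e3 + (X a - X c) * e2 - (X b - X c) * e4
    + e1 - e5 + e6
    - ((X a - X c) * (X a - X b) * e3' + (X a - X c) * e2' - (X a - X b) * e4'
    + e1' - e5' + e6') - hsts

/-- The Schubert polynomials are well defined: the recursion holds at every ascent. -/
theorem schubert_eq_dividedDiff {n : ℕ} (w : Equiv.Perm (Fin n)) (a b : Fin n)
    (hab : a.val + 1 = b.val) (hw : w a < w b) :
    schubert w = dividedDiff a b (schubert (w * Equiv.swap a b)) := by
  induction hN : nonInversions w using Nat.strong_induction_on generalizing w a b with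
  | _ N ih =>
    subst hN
    have ih' : ∀ (v : Equiv.Perm (Fin n)), nonInversions v < nonInversions w → ∀ a b : Fin n,
        a.val + 1 = b.val → v a < v b →
        schubert v = dividedDiff a b (schubert (v * Equiv.swap a b)) :=
      fun v hv a b h1 h2 => ih _ hv v a b h1 h2 rfl
    have key : ∀ a b c d : Fin n, a.val + 1 = b.val → w a < w b → c.val + 1 = d.val →
        w c < w d → a < c →
        dividedDiff a b (schubert (w * Equiv.swap a b)) =
          dividedDiff c d (schubert (w * Equiv.swap c d)) := by
      intro a b c d hab hwab hcd hwcd hac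
      rw [Fin.lt_def] at hac
      have nab : a ≠ b := by rw [Ne, Fin.ext_iff]; omega
      have ncd : c ≠ d := by rw [Ne, Fin.ext_iff]; omega
      have nac : a ≠ c := by rw [Ne, Fin.ext_iff]; omega
      have nad : a ≠ d := by rw [Ne, Fin.ext_iff]; omega
      have nbd : b ≠ d := by rw [Ne, Fin.ext_iff]; omega
      have l1 := nonInversions_mul_swap_lt w a b hab hwab
      have l2 := nonInversions_mul_swap_lt w c d hcd hwcd
      by_cases hbc : b = c
      · subst hbc
        have sd : Equiv.swap a b d = d := Equiv.swap_apply_of_ne_of_ne nad.symm nbd.symm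
        have ta : Equiv.swap b d a = a := Equiv.swap_apply_of_ne_of_ne nac nad
        have a1 : (w * Equiv.swap a b) b < (w * Equiv.swap a b) d := by
          simp only [Equiv.Perm.mul_apply, Equiv.swap_apply_right, sd]
          exact hwab.trans hwcd
        have a2 : (w * Equiv.swap a b * Equiv.swap b d) a <
            (w * Equiv.swap a b * Equiv.swap b d) b := by
          simp only [Equiv.Perm.mul_apply, Equiv.swap_apply_left, sd, ta]
          exact hwcd
        have b1 : (w * Equiv.swap b d) a < (w * Equiv.swap b d) b := by
          simp only [Equiv.Perm.mul_apply, Equiv.swap_apply_left, ta]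
          exact hwab.trans hwcd
        have b2 : (w * Equiv.swap b d * Equiv.swap a b) b <
            (w * Equiv.swap b d * Equiv.swap a b) d := by
          simp only [Equiv.Perm.mul_apply, Equiv.swap_apply_right, sd, ta]
          exact hwab
        have m1 := nonInversions_mul_swap_lt _ b d hcd a1
        have m2 := nonInversions_mul_swap_lt _ a b hab b1
        have hbr : w * Equiv.swap a b * Equiv.swap b d * Equiv.swap a b =
            w * Equiv.swap b d * Equiv.swap a b * Equiv.swap b d := by
          ext1 x
          simp only [Equiv.Perm.mul_apply]
          congr 1
          simp only [Equiv.swap_apply_def]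
          grind
        rw [ih' _ l1 b d hcd a1, ih' _ (m1.trans l1) a b hab a2,
          ih' _ l2 a b hab b1, ih' _ (m2.trans l2) b d hcd b2, hbr,
          dividedDiff_braid nab ncd nad]
      · have a1 : (w * Equiv.swap a b) c < (w * Equiv.swap a b) d := by
          simp only [Equiv.Perm.mul_apply]
          rwa [Equiv.swap_apply_of_ne_of_ne nac.symm (Ne.symm hbc),
            Equiv.swap_apply_of_ne_of_ne nad.symm nbd.symm]
        have b1 : (w * Equiv.swap c d) a < (w * Equiv.swap c d) b := by
          simp only [Equiv.Perm.mul_apply]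
          rwa [Equiv.swap_apply_of_ne_of_ne nac nad, Equiv.swap_apply_of_ne_of_ne hbc nbd]
        have hcm : w * Equiv.swap a b * Equiv.swap c d = w * Equiv.swap c d * Equiv.swap a b := by
          ext1 x
          simp only [Equiv.Perm.mul_apply]
          congr 1
          simp only [Equiv.swap_apply_def]
          grind
        rw [ih' _ l1 c d hcd a1, ih' _ l2 a b hab b1, hcm,
          dividedDiff_comm nab ncd nac nad hbc nbd]
    have hne : w ≠ Fin.revPerm := by
      rintro rfl
      rw [Fin.revPerm_apply, Fin.revPerm_apply, Fin.rev_lt_rev, Fin.lt_def] at hw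
      omega
    rw [schubert, dif_neg hne]
    obtain ⟨h1, h2⟩ := (exists_ascent w hne).choose_spec
    set p := (exists_ascent w hne).choose
    rcases lt_trichotomy a p.1 with h | h | h
    · exact (key a b p.1 p.2 hab hw h1 h2 h).symm
    · have hb : b = p.2 := by rw [Fin.ext_iff, ← hab, ← h1, h]
      rw [h, hb]
    · exact key p.1 p.2 a b h1 h2 hab hw h

/-- `ν_w`, the value of the Schubert polynomial of `w` at `(1, …, 1)`. -/
noncomputable def nu {n : ℕ} (w : Equiv.Perm (Fin n)) : ℤ :=
  eval (fun _ => 1) (schubert w)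

/-- The occurrences of the pattern 132 in `w`. -/
def patterns132 {n : ℕ} (w : Equiv.Perm (Fin n)) : Finset (Fin n × Fin n × Fin n) :=
  Finset.univ.filter fun t =>
    t.1 < t.2.1 ∧ t.2.1 < t.2.2 ∧ w t.1 < w t.2.2 ∧ w t.2.2 < w t.2.1

/-- `η_w`, the number of occurrences of the pattern 132 in `w`. -/
def eta {n : ℕ} (w : Equiv.Perm (Fin n)) : ℕ := (patterns132 w).card

end SchubertPoly

namespace SchubertPoly

variable {n : ℕ}

/-! The engine is Monk's rule, which expands `x_r 𝔖_w` as the signed sum of `𝔖_{w t}` over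
transpositions `t` moving `r` with `w t` covering `w`. Inside `S_n` it can fail, but it holds when
some larger value stands to the right of `r` (`monkDefect_eq_zero`). At the first ascent `i` every
entry to the left exceeds `w i`, so no negative term occurs, and setting all variables to 1 gives
`ν_w = ∑ ν_{w t_{ib}}` over the covers (`IsFirstAscent.nu_eq_sum`). All these permutations are
lexicographically larger, which permits induction.

With `j` the position after `i`, passing to `w s_i` loses exactly the 132 patterns `(i, j, k)`,
indexed by `gapPositions` (`IsFirstAscent.eta_eq`). If there are any, the `k` of smallest value
gives a second cover, whose own patterns account for all but one of them. Hence `η_w + 1 ≤ ν_w`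
(`eta_add_one_le_nu`). If `η_w = 0`, the Schubert polynomial is a monomial and `ν_w = 1`. If `η_w =
1`, the sum has either one term, again with `η = 1`, or two terms with `η = 0`, so `ν_w = 2`. These
three facts give the equivalence. -/

/-! ### Divided differences and their action on Schubert polynomials. -/

theorem dividedDiff_eq_of_mul_eq {a b : Fin n} (hab : a ≠ b) {f g : MvPolynomial (Fin n) ℤ}
    (h : (X a - X b) * g = f - swapVars a b f) : dividedDiff a b f = g :=
  mul_left_cancel₀ (X_sub_X_ne_zero hab) ((mul_dividedDiff a b f).trans h.symm)

theorem swapVars_add (a b : Fin n) (f g : MvPolynomial (Fin n) ℤ) :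
    swapVars a b (f + g) = swapVars a b f + swapVars a b g := by
  simp [swapVars]

theorem dividedDiff_add {a b : Fin n} (hab : a ≠ b) (f g : MvPolynomial (Fin n) ℤ) :
    dividedDiff a b (f + g) = dividedDiff a b f + dividedDiff a b g := by
  apply dividedDiff_eq_of_mul_eq hab
  rw [mul_add, mul_dividedDiff, mul_dividedDiff, swapVars_add]
  ring

/-- The divided difference as an additive homomorphism. -/
noncomputable def dividedDiffHom {a b : Fin n} (hab : a ≠ b) :
    MvPolynomial (Fin n) ℤ →+ MvPolynomial (Fin n) ℤ :=
  AddMonoidHom.mk' (dividedDiff a b) (dividedDiff_add hab)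

theorem dividedDiff_sub {a b : Fin n} (hab : a ≠ b) (f g : MvPolynomial (Fin n) ℤ) :
    dividedDiff a b (f - g) = dividedDiff a b f - dividedDiff a b g :=
  map_sub (dividedDiffHom hab) f g

theorem dividedDiff_zero {a b : Fin n} (hab : a ≠ b) :
    dividedDiff a b (0 : MvPolynomial (Fin n) ℤ) = 0 :=
  map_zero (dividedDiffHom hab)

theorem dividedDiff_sum {a b : Fin n} (hab : a ≠ b) {ι : Type*} (s : Finset ι)
    (f : ι → MvPolynomial (Fin n) ℤ) :
    dividedDiff a b (∑ i ∈ s, f i) = ∑ i ∈ s, dividedDiff a b (f i) :=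
  map_sum (dividedDiffHom hab) f s

/-- The twisted Leibniz rule for a linear factor; its correction term will cancel the one in
`dividedDiff_monkTerm`. -/
theorem dividedDiff_X_mul {a b : Fin n} (hab : a ≠ b) (r : Fin n) (f : MvPolynomial (Fin n) ℤ) :
    dividedDiff a b (X (Equiv.swap a b r) * f) =
      X r * dividedDiff a b f +
        ((if r = b then 1 else 0) - (if r = a then 1 else 0)) * f := by
  apply dividedDiff_eq_of_mul_eq hab
  have h := mul_dividedDiff a b f
  rw [swapVars_mul, swapVars_X, Equiv.swap_apply_self]
  by_cases hb : r = b
  · subst hb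
    simp only [Equiv.swap_apply_right, if_true, if_neg hab.symm]
    linear_combination X r * h
  · by_cases ha : r = a
    · subst ha
      simp only [Equiv.swap_apply_left, if_true, if_neg hab]
      linear_combination X r * h
    · simp only [Equiv.swap_apply_of_ne_of_ne ha hb, if_neg ha, if_neg hb]
      linear_combination X r * h

theorem dividedDiff_eq_zero {a b : Fin n} (hab : a ≠ b) {f : MvPolynomial (Fin n) ℤ}
    (h : swapVars a b f = f) : dividedDiff a b f = 0 :=
  dividedDiff_eq_of_mul_eq hab (by rw [h, mul_zero, sub_self])

theorem ne_of_val_succ {a b : Fin n} (hab : a.val + 1 = b.val) : a ≠ b := by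
  rintro rfl; omega

theorem dividedDiff_schubert_of_lt (w : Equiv.Perm (Fin n)) {a b : Fin n}
    (hab : a.val + 1 = b.val) (hw : w a < w b) : dividedDiff a b (schubert w) = 0 := by
  rw [schubert_eq_dividedDiff w a b hab hw]
  exact dividedDiff_eq_zero (ne_of_val_succ hab) (swapVars_dividedDiff (ne_of_val_succ hab) _)

theorem dividedDiff_schubert_of_gt (w : Equiv.Perm (Fin n)) {a b : Fin n}
    (hab : a.val + 1 = b.val) (hw : w b < w a) :
    dividedDiff a b (schubert w) = schubert (w * Equiv.swap a b) := by
  rw [schubert_eq_dividedDiff (w * Equiv.swap a b) a b hab (by simpa using hw), mul_assoc,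
    Equiv.swap_mul_self, mul_one]

/-! ### Monk's rule under divided differences. -/

/-- `a < b` are positions such that `w * swap a b` covers `w` in the Bruhat order. -/
def IsCoverPair (w : Equiv.Perm (Fin n)) (a b : Fin n) : Prop :=
  a < b ∧ w a < w b ∧ ∀ c, a < c → c < b → ¬ (w a < w c ∧ w c < w b)

/-- Conjugation by `s_i` matches the covers of `w` with those covers of `w s_i` whose term survives
`∂_i`, which is what the ascent condition on `w t_{ab}` detects. -/
theorem isCoverPair_iff_mul_swap (w : Equiv.Perm (Fin n)) {i j a b : Fin n}
    (hij : i.val + 1 = j.val) (hw : w i < w j) (hab : ¬ (a = i ∧ b = j)) (hba : ¬ (a = j ∧ b = i)) :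
    IsCoverPair w a b ↔
      IsCoverPair (w * Equiv.swap i j) (Equiv.swap i j a) (Equiv.swap i j b) ∧
        (w * Equiv.swap a b) i < (w * Equiv.swap a b) j := by
  have hval : ∀ c, w c = w i → c = i := fun c h => w.injective h
  have hval' : ∀ c, w c = w j → c = j := fun c h => w.injective h
  have hval2 : ∀ c, w c = w a → c = a := fun c h => w.injective h
  have hval3 : ∀ c, w c = w b → c = b := fun c h => w.injective h
  have hs : ∀ c, Equiv.swap i j c = if c = i then j else if c = j then i else c :=
    fun c => Equiv.swap_apply_def i j c
  have ht : ∀ c, Equiv.swap a b c = if c = a then b else if c = b then a else c :=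
    fun c => Equiv.swap_apply_def a b c
  simp only [IsCoverPair, Equiv.Perm.mul_apply, Equiv.swap_apply_self]
  constructor
  · rintro ⟨h1, h2, h3⟩
    have h3i := h3 i
    have h3j := h3 j
    refine ⟨⟨?_, h2, fun c hc1 hc2 hc3 => ?_⟩, ?_⟩
    · rw [hs, hs]; split_ifs <;> grind
    · have := h3 (Equiv.swap i j c)
      rw [hs] at hc1 hc2 hc3 this
      grind
    · rw [ht, ht]; grind
  · rintro ⟨⟨h1, h2, h3⟩, h4⟩
    have h3i := h3 i
    have h3j := h3 j
    rw [ht, ht] at h4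
    refine ⟨?_, h2, fun c hc1 hc2 hc3 => ?_⟩
    · rw [hs, hs] at h1; grind
    · have := h3 (Equiv.swap i j c)
      rw [Equiv.swap_apply_self, hs, hs, hs] at this
      grind

open Classical in
/-- The signed contribution of the transposition `(r b)` to Monk's rule for `x_r 𝔖_w`. -/
noncomputable def monkTerm (w : Equiv.Perm (Fin n)) (r b : Fin n) : MvPolynomial (Fin n) ℤ :=
  if IsCoverPair w r b then schubert (w * Equiv.swap r b)
  else if IsCoverPair w b r then -schubert (w * Equiv.swap b r) else 0

/-- The defect in Monk's rule for `x_r 𝔖_w`, when only transpositions within `S_n` are used. -/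
noncomputable def monkDefect (w : Equiv.Perm (Fin n)) (r : Fin n) : MvPolynomial (Fin n) ℤ :=
  X r * schubert w - ∑ b, monkTerm w r b

theorem IsCoverPair.not_symm {w : Equiv.Perm (Fin n)} {a b : Fin n} (h : IsCoverPair w a b) :
    ¬ IsCoverPair w b a := fun h' => lt_asymm h.1 h'.1

open Classical in
theorem dividedDiff_coverTerm (w : Equiv.Perm (Fin n)) {i j : Fin n} (hij : i.val + 1 = j.val)
    (hw : w i < w j) {a b : Fin n} (hab : ¬ (a = i ∧ b = j)) (hba : ¬ (a = j ∧ b = i)) :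
    dividedDiff i j
        (if IsCoverPair (w * Equiv.swap i j) (Equiv.swap i j a) (Equiv.swap i j b) then
          schubert (w * Equiv.swap i j * Equiv.swap (Equiv.swap i j a) (Equiv.swap i j b)) else 0) =
      if IsCoverPair w a b then schubert (w * Equiv.swap a b) else 0 := by
  have hconj : w * Equiv.swap i j * Equiv.swap (Equiv.swap i j a) (Equiv.swap i j b) =
      w * Equiv.swap a b * Equiv.swap i j := by
    rw [mul_assoc, mul_assoc]
    congr 1
    rw [Equiv.swap_apply_apply, Equiv.swap_inv, mul_assoc, ← mul_assoc, Equiv.swap_mul_self,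
      one_mul]
  have key := isCoverPair_iff_mul_swap w hij hw hab hba
  have hne := ne_of_val_succ hij
  rw [hconj]
  by_cases h : IsCoverPair (w * Equiv.swap i j) (Equiv.swap i j a) (Equiv.swap i j b)
  · rw [if_pos h]
    by_cases h' : (w * Equiv.swap a b) i < (w * Equiv.swap a b) j
    · rw [if_pos (key.2 ⟨h, h'⟩), dividedDiff_schubert_of_gt _ hij (by simpa using h'),
        mul_assoc, Equiv.swap_mul_self, mul_one]
    · rw [if_neg (fun h2 => h' (key.1 h2).2), dividedDiff_schubert_of_lt _ hij]
      have : (w * Equiv.swap a b) i ≠ (w * Equiv.swap a b) j :=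
        fun h => hne ((w * Equiv.swap a b).injective h)
      have := lt_of_le_of_ne (not_lt.1 h') this.symm
      simpa using this
  · rw [if_neg h, if_neg (fun h2 => h (key.1 h2).1), dividedDiff_zero hne]

open Classical in
theorem monkTerm_eq (w : Equiv.Perm (Fin n)) (r b : Fin n) :
    monkTerm w r b = (if IsCoverPair w r b then schubert (w * Equiv.swap r b) else 0) -
      (if IsCoverPair w b r then schubert (w * Equiv.swap b r) else 0) := by
  unfold monkTerm
  by_cases h : IsCoverPair w r b
  · simp [h, h.not_symm]
  · by_cases h' : IsCoverPair w b r <;> simp [h, h']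

theorem isCoverPair_of_val_succ {w : Equiv.Perm (Fin n)} {i j : Fin n} (hij : i.val + 1 = j.val)
    (hw : w i < w j) : IsCoverPair w i j :=
  ⟨by rw [Fin.lt_def]; omega, hw, fun c h1 h2 => by rw [Fin.lt_def] at h1 h2; omega⟩

/-- Terms correspond under conjugation except for the transposition `(i j)` itself, which gives a
cover of `w` but not of `w s_i`; hence the two corrections. -/
theorem dividedDiff_monkTerm (w : Equiv.Perm (Fin n)) {i j : Fin n} (hij : i.val + 1 = j.val)
    (hw : w i < w j) (r b : Fin n) :
    dividedDiff i j (monkTerm (w * Equiv.swap i j) (Equiv.swap i j r) (Equiv.swap i j b)) =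
      monkTerm w r b -
        (if r = i ∧ b = j then schubert (w * Equiv.swap i j) else 0) +
        (if r = j ∧ b = i then schubert (w * Equiv.swap i j) else 0) := by
  have hne := ne_of_val_succ hij
  have hlt : i < j := by rw [Fin.lt_def]; omega
  have hc := isCoverPair_of_val_succ hij hw
  have h1 : ¬ IsCoverPair (w * Equiv.swap i j) i j := by
    rintro ⟨-, h, -⟩
    simp only [Equiv.Perm.mul_apply, Equiv.swap_apply_left, Equiv.swap_apply_right] at h
    exact lt_asymm h hw
  have h2 : ¬ IsCoverPair (w * Equiv.swap i j) j i := fun h => lt_asymm h.1 hlt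
  by_cases hab : r = i ∧ b = j
  · obtain ⟨rfl, rfl⟩ := hab
    simp [monkTerm, h1, h2, hc, hne, dividedDiff_zero hne]
  · by_cases hba : r = j ∧ b = i
    · obtain ⟨rfl, rfl⟩ := hba
      simp [monkTerm, h1, h2, hc, hc.not_symm, hne, dividedDiff_zero hne]
    · rw [if_neg hab, if_neg hba, monkTerm_eq, monkTerm_eq, dividedDiff_sub hne,
        dividedDiff_coverTerm w hij hw hab hba,
        dividedDiff_coverTerm w hij hw (fun h => hba h.symm) (fun h => hab h.symm)]
      ring

/-- The missing terms for `(i j)` are exactly the corrections in the Leibniz rule, so vanishing of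
the defect descends from `w s_i` to `w`. -/
theorem dividedDiff_monkDefect (w : Equiv.Perm (Fin n)) {i j : Fin n} (hij : i.val + 1 = j.val)
    (hw : w i < w j) (r : Fin n) :
    dividedDiff i j (monkDefect (w * Equiv.swap i j) (Equiv.swap i j r)) = monkDefect w r := by
  have hne := ne_of_val_succ hij
  unfold monkDefect
  rw [dividedDiff_sub hne, dividedDiff_X_mul hne, ← schubert_eq_dividedDiff w i j hij hw,
    ← Equiv.sum_comp (Equiv.swap i j), dividedDiff_sum hne]
  simp only [dividedDiff_monkTerm w hij hw, Finset.sum_add_distrib, Finset.sum_sub_distrib]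
  by_cases hi : r = i
  · subst hi
    simp [hne]
    ring
  · by_cases hj : r = j
    · subst hj
      simp [hi]
    · simp [hi, hj]

/-! ### First ascents, Lehmer codes and 132-avoiding permutations. -/

/-- `(i, j)` is the first ascent of `w`. -/
def IsFirstAscent (w : Equiv.Perm (Fin n)) (i j : Fin n) : Prop :=
  i.val + 1 = j.val ∧ w i < w j ∧ ∀ a, a < i → w i < w a

theorem exists_isFirstAscent (w : Equiv.Perm (Fin n)) (hw : w ≠ Fin.revPerm) :
    ∃ i j, IsFirstAscent w i j := by
  classical
  let s : Finset (Fin n × Fin n) :=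
    Finset.univ.filter fun p => p.1.val + 1 = p.2.val ∧ w p.1 < w p.2
  have hs : s.Nonempty := by
    obtain ⟨p, hp⟩ := exists_ascent w hw
    exact ⟨p, by simpa [s] using hp⟩
  obtain ⟨p, hp, hmin⟩ := s.exists_min_image (fun p => p.1) hs
  obtain ⟨h1, h2⟩ : p.1.val + 1 = p.2.val ∧ w p.1 < w p.2 := by simpa [s] using hp
  refine ⟨p.1, p.2, h1, h2, ?_⟩
  -- By minimality of the ascent, `w` decreases step by step up to `p.1`.
  have key : ∀ k : ℕ, ∀ a : Fin n, a.val + k + 1 = p.1.val → w p.1 < w a := by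
    intro k
    induction k with
    | zero =>
      intro a ha
      by_contra h
      have hne : w a ≠ w p.1 := fun h => by have := w.injective h; rw [Fin.ext_iff] at this; omega
      have := hmin (a, p.1) (by
        simp only [s, Finset.mem_filter, Finset.mem_univ, true_and]
        exact ⟨by omega, lt_of_le_of_ne (not_lt.1 h) hne⟩)
      simp only [Fin.le_def] at this
      omega
    | succ k ih =>
      intro a ha
      have hb : a.val + 1 < n := by omega
      have h3 := ih ⟨a.val + 1, hb⟩ (by simp only; omega)
      by_contra h
      have := hmin (a, ⟨a.val + 1, hb⟩) (by
        simp only [s, Finset.mem_filter, Finset.mem_univ, true_and]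
        exact (not_lt.1 h).trans_lt h3)
      simp only [Fin.le_def] at this
      omega
  intro a ha
  rw [Fin.lt_def] at ha
  exact key (p.1.val - a.val - 1) a (by omega)

/-- The entries of the Lehmer code of `w`. -/
def code (w : Equiv.Perm (Fin n)) (a : Fin n) : ℕ :=
  (Finset.univ.filter fun b => a < b ∧ w b < w a).card

/-- The monomial whose exponent vector is the Lehmer code of `w`. -/
noncomputable def codeMonomial (w : Equiv.Perm (Fin n)) : MvPolynomial (Fin n) ℤ :=
  ∏ a, X a ^ code w a

/-- `w` has no occurrence of the pattern 132. -/
def Avoids132 (w : Equiv.Perm (Fin n)) : Prop :=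
  ∀ a b c, a < b → b < c → w a < w c → ¬ w c < w b

theorem code_revPerm (a : Fin n) : code (Fin.revPerm : Equiv.Perm (Fin n)) a = n - 1 - a.val := by
  have : (Finset.univ.filter fun b : Fin n =>
      a < b ∧ (Fin.revPerm : Equiv.Perm (Fin n)) b < (Fin.revPerm : Equiv.Perm (Fin n)) a) =
      Finset.Ioi a := by
    ext b
    simp
  rw [code, this, Fin.card_Ioi]

theorem code_eq_of_gap {w : Equiv.Perm (Fin n)} {i j : Fin n} (hij : i.val + 1 = j.val)
    (hw : w i < w j) (hgap : ∀ k, j < k → w i < w k → ¬ w k < w j) : code w i = code w j := by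
  unfold code
  congr 1
  ext b
  have hval : w b = w i → b = i := fun h => w.injective h
  have := hgap b
  simp only [Finset.mem_filter, Finset.mem_univ, true_and]
  grind

theorem code_mul_swap_of_ne (w : Equiv.Perm (Fin n)) {i j : Fin n} (hij : i.val + 1 = j.val)
    {a : Fin n} (hi : a ≠ i) (hj : a ≠ j) : code (w * Equiv.swap i j) a = code w a := by
  unfold code
  refine Finset.card_nbij' (Equiv.swap i j) (Equiv.swap i j) ?_ ?_
    (fun _ _ => by simp) (fun _ _ => by simp)
  · intro b
    simp only [Finset.coe_filter, Set.mem_ofPred_eq, Finset.mem_univ, true_and,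
      Equiv.Perm.mul_apply, Equiv.swap_apply_of_ne_of_ne hi hj]
    rintro ⟨h1, h2⟩
    refine ⟨?_, h2⟩
    rw [Equiv.swap_apply_def]; grind
  · intro b
    simp only [Finset.coe_filter, Set.mem_ofPred_eq, Finset.mem_univ, true_and,
      Equiv.Perm.mul_apply, Equiv.swap_apply_of_ne_of_ne hi hj, Equiv.swap_apply_self]
    rintro ⟨h1, h2⟩
    refine ⟨?_, h2⟩
    rw [Equiv.swap_apply_def]; grind

theorem code_mul_swap_left (w : Equiv.Perm (Fin n)) {i j : Fin n} (hij : i.val + 1 = j.val)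
    (hw : w i < w j) : code (w * Equiv.swap i j) i = code w j + 1 := by
  unfold code
  rw [← Finset.card_insert_of_notMem (a := j) (by simp)]
  congr 1
  ext b
  simp only [Finset.mem_filter, Finset.mem_univ, true_and, Finset.mem_insert,
    Equiv.Perm.mul_apply, Equiv.swap_apply_left]
  rw [Equiv.swap_apply_def]; grind

theorem code_mul_swap_right (w : Equiv.Perm (Fin n)) {i j : Fin n} (hij : i.val + 1 = j.val)
    (hw : w i < w j) : code (w * Equiv.swap i j) j = code w i := by
  unfold code
  congr 1
  ext b
  simp only [Finset.mem_filter, Finset.mem_univ, true_and,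
    Equiv.Perm.mul_apply, Equiv.swap_apply_right]
  rw [Equiv.swap_apply_def]; grind

theorem codeMonomial_mul_swap {w : Equiv.Perm (Fin n)} {i j : Fin n} (hij : i.val + 1 = j.val)
    (hw : w i < w j) (hgap : ∀ k, j < k → w i < w k → ¬ w k < w j) :
    codeMonomial (w * Equiv.swap i j) = X i * codeMonomial w := by
  have hne := ne_of_val_succ hij
  have hc := code_eq_of_gap hij hw hgap
  have : (X i : MvPolynomial (Fin n) ℤ) = ∏ a : Fin n, if a = i then X a else 1 := by simp
  unfold codeMonomial
  rw [this, ← Finset.prod_mul_distrib]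
  refine Finset.prod_congr rfl fun a _ => ?_
  by_cases hi : a = i
  · subst hi
    rw [code_mul_swap_left w hij hw, hc, if_pos rfl, pow_succ, mul_comm]
  · rw [if_neg hi, one_mul]
    by_cases hj : a = j
    · subst hj
      rw [code_mul_swap_right w hij hw, hc]
    · rw [code_mul_swap_of_ne w hij hi hj]

theorem swapVars_codeMonomial {w : Equiv.Perm (Fin n)} {i j : Fin n} (h : code w i = code w j) :
    swapVars i j (codeMonomial w) = codeMonomial w := by
  unfold codeMonomial swapVars
  rw [map_prod, ← Equiv.prod_comp (Equiv.swap i j) fun a => (X a : MvPolynomial (Fin n) ℤ) ^ _]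
  refine Finset.prod_congr rfl fun a _ => ?_
  rw [map_pow, rename_X]
  congr 1
  rw [Equiv.swap_apply_def]
  split_ifs with h1 h2
  · rw [h1, h]
  · rw [h2, h]
  · rfl

/-- A new pattern would have to use `i` and `j` as its "3" and "2", with a "1" to the left of `i`
smaller than `w i`; a first ascent forbids that. -/
theorem Avoids132.mul_swap {w : Equiv.Perm (Fin n)} (h : Avoids132 w) {i j : Fin n}
    (hf : IsFirstAscent w i j) : Avoids132 (w * Equiv.swap i j) := by
  obtain ⟨hij, hw, hf⟩ := hf
  intro a b c hab hbc
  simp only [Equiv.Perm.mul_apply]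
  intro h1 h2
  have h3 := h (Equiv.swap i j a) (Equiv.swap i j b) (Equiv.swap i j c)
  have h4 := hf a
  rw [Equiv.swap_apply_def, Equiv.swap_apply_def] at *
  have := Equiv.swap_apply_def i j c
  grind

/-- With an empty gap the code agrees at `i` and `j`, so the code monomial of `w` is symmetric in
`x_i, x_j` and that of `w s_i` is `x_i` times it; `∂_i` just removes the factor `x_i`. -/
theorem schubert_eq_codeMonomial {w : Equiv.Perm (Fin n)} (h : Avoids132 w) :
    schubert w = codeMonomial w := by
  induction hN : nonInversions w using Nat.strong_induction_on generalizing w with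
  | _ N ih =>
    subst hN
    by_cases hne : w = Fin.revPerm
    · subst hne
      rw [schubert_revPerm, codeMonomial]
      simp only [code_revPerm]
    · obtain ⟨i, j, hf⟩ := exists_isFirstAscent w hne
      have h' := h.mul_swap hf
      obtain ⟨hij, hw, -⟩ := hf
      have hgap : ∀ k, j < k → w i < w k → ¬ w k < w j :=
        fun k hk => h i j k (by rw [Fin.lt_def]; omega) hk
      rw [schubert_eq_dividedDiff w i j hij hw,
        ih _ (nonInversions_mul_swap_lt w i j hij hw) h' rfl, codeMonomial_mul_swap hij hw hgap]
      apply dividedDiff_eq_of_mul_eq (ne_of_val_succ hij)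
      rw [swapVars_mul, swapVars_codeMonomial (code_eq_of_gap hij hw hgap), swapVars_X,
        Equiv.swap_apply_left]
      ring

/-! ### Monk's rule within `S_n`, evaluated at 1. -/

theorem apply_lt_of_forall_succ {w : Equiv.Perm (Fin n)} {l m : ℕ}
    (h : ∀ a b : Fin n, l ≤ a.val → b.val ≤ m → a.val + 1 = b.val → w b < w a) {a b : Fin n}
    (ha : l ≤ a.val) (hb : b.val ≤ m) (hab : a < b) : w b < w a := by
  have key : ∀ k : ℕ, ∀ b : Fin n, b.val ≤ m → a.val + k + 1 = b.val → w b < w a := by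
    intro k
    induction k with
    | zero => exact fun b hb h1 => h a b ha hb h1
    | succ k ih =>
      intro b hb h1
      have h2 : a.val + k + 1 < n := by omega
      have h3 := ih ⟨a.val + k + 1, h2⟩ (by simp only; omega) rfl
      exact (h ⟨a.val + k + 1, h2⟩ b (by simp only; omega) hb (by simp only; omega)).trans h3
  rw [Fin.lt_def] at hab
  exact key (b.val - a.val - 1) b hb (by omega)

/-- Monk's rule holds within `S_n` at `r` if `w` has a larger value to the right of `r`. -/
theorem monkDefect_eq_zero (w : Equiv.Perm (Fin n)) {r b : Fin n} (hrb : r < b) (hw : w r < w b) :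
    monkDefect w r = 0 := by
  induction hN : nonInversions w using Nat.strong_induction_on generalizing w r b with
  | _ N ih =>
    subst hN
    -- Unless the ascent is the pair `(r, b)` itself, swapping it keeps `r` and `b` in order with
    -- the same values, so the induction hypothesis applies to `w s_i`.
    by_cases hex : ∃ i j b : Fin n, i.val + 1 = j.val ∧ w i < w j ∧ r < b ∧ w r < w b ∧
        ¬ (i = r ∧ j = b)
    · obtain ⟨i, j, b, hij, hwij, hrb, hw, hne⟩ := hex
      rw [← dividedDiff_monkDefect w hij hwij,
        ih _ (nonInversions_mul_swap_lt w i j hij hwij) (r := Equiv.swap i j r)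
          (b := Equiv.swap i j b) _ _ _ rfl, dividedDiff_zero (ne_of_val_succ hij)]
      · rw [Equiv.swap_apply_def, Equiv.swap_apply_def]
        grind
      · simpa using hw
    -- What remains is a permutation with a single ascent, at `r`, followed by the only larger value
    -- to the right of `r`: both `w` and `w s_i` avoid 132, and Monk's rule is an identity of
    -- monomials.
    · push Not at hex
      have hb : ∀ i j : Fin n, i.val + 1 = j.val → w i < w j → i = r ∧ j = b :=
        fun i j hij hwij => hex i j b hij hwij hrb hw
      obtain ⟨i, j, hij, hwij⟩ : ∃ i j : Fin n, i.val + 1 = j.val ∧ w i < w j := by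
        have : w ≠ Fin.revPerm := by
          rintro rfl
          rw [Fin.revPerm_apply, Fin.revPerm_apply, Fin.rev_lt_rev] at hw
          exact lt_asymm hw hrb
        obtain ⟨p, h1, h2⟩ := exists_ascent w this
        exact ⟨_, _, h1, h2⟩
      obtain ⟨rfl, rfl⟩ := hb i j hij hwij
      have honly : ∀ c, i < c → w i < w c → j = c :=
        fun c h1 h2 => (hex i j c hij hwij h1 h2).2
      have hinj : ∀ c d, w c = w d → c = d := fun c d h => w.injective h
      have hdesc : ∀ a c : Fin n, a.val + 1 = c.val → a ≠ i → w c < w a := by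
        intro a c hac hai
        have := hb a c hac
        have := hinj a c
        grind
      have hleft : ∀ a c : Fin n, a < c → c ≤ i → w c < w a := by
        intro a c hac hc
        refine apply_lt_of_forall_succ (l := 0) (m := i.val) ?_ (Nat.zero_le _) hc hac
        intro a c _ hc hac
        exact hdesc a c hac (by rintro rfl; omega)
      have hright : ∀ a c : Fin n, j ≤ a → a < c → w c < w a := by
        intro a c hja hac
        refine apply_lt_of_forall_succ (l := j.val) (m := n) ?_ hja c.isLt.le hac
        intro a c ha _ hac
        exact hdesc a c hac (by rintro rfl; omega)
      have hav : Avoids132 w := by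
        intro a b c hab hbc h1 h2
        have := hleft a b
        have := hright a b
        have := hright b c
        have := hleft a i
        have := honly c
        clear ih hex hb hdesc hleft hright honly hinj
        rcases lt_trichotomy a i with h | rfl | h <;> grind
      have hf : IsFirstAscent w i j := ⟨hij, hwij, fun a ha => hleft a i ha le_rfl⟩
      have hsum : ∑ b, monkTerm w i b = schubert (w * Equiv.swap i j) := by
        rw [Finset.sum_eq_single j]
        · rw [monkTerm, if_pos (isCoverPair_of_val_succ hij hwij)]
        · intro c _ hc
          rw [monkTerm, if_neg (fun h => hc (honly c h.1 h.2.1).symm),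
            if_neg (fun h => lt_asymm h.2.1 (hleft c i h.1 le_rfl))]
        · simp
      rw [monkDefect, hsum, schubert_eq_codeMonomial hav, schubert_eq_codeMonomial (hav.mul_swap hf),
        codeMonomial_mul_swap hij hwij (fun k hk h => absurd (honly k (hrb.trans hk) h) hk.ne),
        sub_self]

open Classical in
theorem IsFirstAscent.nu_eq_sum {w : Equiv.Perm (Fin n)} {i j : Fin n} (hf : IsFirstAscent w i j) :
    nu w = ∑ b ∈ Finset.univ.filter (IsCoverPair w i), nu (w * Equiv.swap i b) := by
  obtain ⟨hij, hw, hf⟩ := hf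
  have h := monkDefect_eq_zero w (r := i) (b := j) (by rw [Fin.lt_def]; omega) hw
  rw [monkDefect, sub_eq_zero] at h
  have h2 := congrArg (eval fun _ => (1 : ℤ)) h
  rw [map_mul, eval_X, one_mul, map_sum] at h2
  rw [nu, h2, Finset.sum_filter]
  refine Finset.sum_congr rfl fun b _ => ?_
  -- Negative terms need a smaller entry to the left of `i`.
  have hno : ¬ IsCoverPair w b i := fun h => lt_asymm h.2.1 (hf b h.1)
  rw [monkTerm, if_neg hno, nu]
  split_ifs <;> simp

/-! ### Lexicographic induction and counting 132 patterns. -/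

theorem lex_lt_mul_swap {w : Equiv.Perm (Fin n)} {a b : Fin n} (hab : a < b) (hw : w a < w b) :
    toLex (⇑w) < toLex (⇑(w * Equiv.swap a b)) := by
  refine ⟨a, fun c hc => ?_, ?_⟩
  · have h1 : c ≠ a := hc.ne
    have h2 : c ≠ b := (hc.trans hab).ne
    simp [Equiv.swap_apply_of_ne_of_ne h1 h2]
  · simpa using hw

/-- Induction over permutations, from larger to smaller ones in the lexicographic order. -/
theorem perm_lex_induction {P : Equiv.Perm (Fin n) → Prop}
    (h : ∀ w, (∀ a b, a < b → w a < w b → P (w * Equiv.swap a b)) → P w)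
    (w : Equiv.Perm (Fin n)) : P w := by
  have wf : WellFounded fun x y : Lex (Fin n → Fin n) => y < x :=
    (inferInstance : WellFoundedGT (Lex (Fin n → Fin n))).wf
  have key : ∀ f : Lex (Fin n → Fin n), ∀ w : Equiv.Perm (Fin n), toLex (⇑w) = f → P w := by
    intro f
    induction f using wf.induction with
    | _ f ih =>
      rintro w rfl
      exact h w fun a b hab hw => ih _ (lex_lt_mul_swap hab hw) _ rfl
  exact key _ w rfl

/-- The positions to the right of `j` whose values lie between `w i` and `w j`. -/
def gapPositions (w : Equiv.Perm (Fin n)) (i j : Fin n) : Finset (Fin n) :=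
  Finset.univ.filter fun k => j < k ∧ w i < w k ∧ w k < w j

theorem mem_gapPositions {w : Equiv.Perm (Fin n)} {i j k : Fin n} :
    k ∈ gapPositions w i j ↔ j < k ∧ w i < w k ∧ w k < w j := by
  simp [gapPositions]

theorem mem_patterns132 {w : Equiv.Perm (Fin n)} {a b c : Fin n} :
    (a, b, c) ∈ patterns132 w ↔ a < b ∧ b < c ∧ w a < w c ∧ w c < w b := by
  simp [patterns132]

/-- Patterns other than the `(i, j, k)` are carried to the patterns of `w s_i` by `s_i` acting on
positions; no pattern of `w s_i` has `i, j` as its "3" and "2", since nothing left of `i` is below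
`w i`. -/
theorem IsFirstAscent.eta_eq {w : Equiv.Perm (Fin n)} {i j : Fin n} (hf : IsFirstAscent w i j) :
    eta w = eta (w * Equiv.swap i j) + (gapPositions w i j).card := by
  obtain ⟨hij, hw, hf⟩ := hf
  have hs : ∀ c, Equiv.swap i j c = if c = i then j else if c = j then i else c :=
    fun c => Equiv.swap_apply_def i j c
  unfold eta
  rw [← Finset.card_filter_add_card_filter_not (s := patterns132 w)
    (fun t => t.1 = i ∧ t.2.1 = j), add_comm]
  congr 1
  · refine Finset.card_nbij'
      (fun t => (Equiv.swap i j t.1, Equiv.swap i j t.2.1, Equiv.swap i j t.2.2))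
      (fun t => (Equiv.swap i j t.1, Equiv.swap i j t.2.1, Equiv.swap i j t.2.2)) ?_ ?_
      (fun _ _ => by simp) (fun _ _ => by simp)
    · rintro ⟨a, b, c⟩
      simp only [Finset.coe_filter, Set.mem_ofPred_eq, mem_patterns132, Finset.mem_coe,
        Equiv.Perm.mul_apply, Equiv.swap_apply_self]
      rintro ⟨⟨h1, h2, h3, h4⟩, h5⟩
      refine ⟨?_, ?_, h3, h4⟩ <;> rw [hs, hs] <;> grind
    · rintro ⟨a, b, c⟩
      simp only [Finset.coe_filter, Set.mem_ofPred_eq, mem_patterns132, Finset.mem_coe,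
        Equiv.Perm.mul_apply]
      rintro ⟨h1, h2, h3, h4⟩
      have h5 := hf a
      rw [hs] at h3 h4
      rw [hs] at h3 h4
      refine ⟨⟨?_, ?_, ?_, ?_⟩, ?_⟩ <;> simp only [hs] <;> grind
  · refine Finset.card_nbij' (fun t => t.2.2) (fun k => (i, j, k)) ?_ ?_ ?_ ?_
    · rintro ⟨a, b, c⟩
      simp only [Finset.coe_filter, Set.mem_ofPred_eq, mem_patterns132, Finset.mem_coe,
        mem_gapPositions]
      rintro ⟨⟨h1, h2, h3, h4⟩, rfl, rfl⟩
      exact ⟨h2, h3, h4⟩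
    · intro k
      simp only [Finset.coe_filter, Set.mem_ofPred_eq, mem_patterns132, Finset.mem_coe,
        mem_gapPositions]
      rintro ⟨h1, h2, h3⟩
      exact ⟨⟨by rw [Fin.lt_def]; omega, h1, h2, h3⟩, trivial, trivial⟩
    · rintro ⟨a, b, c⟩
      simp only [Finset.coe_filter, Set.mem_ofPred_eq]
      rintro ⟨-, rfl, rfl⟩
      rfl
    · exact fun _ _ => rfl

theorem exists_min_gapPosition {w : Equiv.Perm (Fin n)} {i j : Fin n} (hij : i.val + 1 = j.val)
    (hne : (gapPositions w i j).Nonempty) :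
    ∃ b ∈ gapPositions w i j, IsCoverPair w i b ∧ ∀ c, i < c → w i < w c → w b ≤ w c := by
  obtain ⟨b, hb, hmin⟩ := (gapPositions w i j).exists_min_image w hne
  have hb' := mem_gapPositions.1 hb
  have hmin' : ∀ c, i < c → w i < w c → w b ≤ w c := by
    intro c hc hwc
    by_cases hcj : w c < w j
    · exact hmin c (mem_gapPositions.2 ⟨by
        have : c ≠ j := by rintro rfl; exact lt_irrefl _ hcj
        rw [Fin.lt_def] at *; rw [Ne, Fin.ext_iff] at this; omega, hwc, hcj⟩)
    · exact hb'.2.2.le.trans (not_lt.1 hcj)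
  refine ⟨b, hb, ⟨by have := hb'.1; rw [Fin.lt_def] at *; omega, hb'.2.1, ?_⟩, hmin'⟩
  rintro c hc - ⟨h1, h2⟩
  exact absurd (hmin' c hc h1) (not_le.2 h2)

/-- For every other gap position `k`, `(i, j, k)` is still a 132 pattern after the swap, because `w
b` is the smallest value in the gap. -/
theorem card_gapPositions_le {w : Equiv.Perm (Fin n)} {i j b : Fin n} (hij : i.val + 1 = j.val)
    (hb : b ∈ gapPositions w i j) (hmin : ∀ c, i < c → w i < w c → w b ≤ w c) :
    (gapPositions w i j).card ≤ eta (w * Equiv.swap i b) + 1 := by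
  rw [← Finset.card_erase_add_one hb]
  refine Nat.add_le_add_right ?_ 1
  refine Finset.card_le_card_of_injOn (fun k => (i, j, k)) ?_ ?_
  · intro k hk
    obtain ⟨hkb, hk⟩ := Finset.mem_erase.1 (Finset.mem_coe.1 hk)
    rw [mem_gapPositions] at hk hb
    have hji : i < j := by rw [Fin.lt_def]; omega
    have hik : i < k := hji.trans hk.1
    have hle := hmin k hik hk.2.1
    rw [Finset.mem_coe, mem_patterns132]
    simp only [Equiv.Perm.mul_apply, Equiv.swap_apply_left,
      Equiv.swap_apply_of_ne_of_ne hik.ne' hkb, Equiv.swap_apply_of_ne_of_ne hji.ne' hb.1.ne]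
    exact ⟨hji, hk.1, lt_of_le_of_ne hle fun h => hkb (w.injective h).symm, hk.2.2⟩
  · intro k _ l _ h
    simpa using h

theorem avoids132_of_eta_eq_zero {w : Equiv.Perm (Fin n)} (h : eta w = 0) : Avoids132 w := by
  intro a b c hab hbc h1 h2
  rw [eta, Finset.card_eq_zero] at h
  have := mem_patterns132.2 ⟨hab, hbc, h1, h2⟩
  simp [h] at this

theorem eta_eq_zero_of_avoids132 {w : Equiv.Perm (Fin n)} (h : Avoids132 w) : eta w = 0 := by
  rw [eta, Finset.card_eq_zero, Finset.eq_empty_iff_forall_notMem]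
  rintro ⟨a, b, c⟩ hm
  obtain ⟨h1, h2, h3, h4⟩ := mem_patterns132.1 hm
  exact h a b c h1 h2 h3 h4

/-! ### The lower bound for `ν` and the case of a single pattern. -/

theorem nu_eq_one_of_eta_eq_zero {w : Equiv.Perm (Fin n)} (h : eta w = 0) : nu w = 1 := by
  rw [nu, schubert_eq_codeMonomial (avoids132_of_eta_eq_zero h), codeMonomial]
  simp

theorem avoids132_revPerm : Avoids132 (Fin.revPerm : Equiv.Perm (Fin n)) := by
  intro a b c hab hbc h1
  rw [Fin.revPerm_apply, Fin.revPerm_apply, Fin.rev_lt_rev] at h1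
  exact absurd (hab.trans hbc) h1.asymm

theorem eta_add_one_le_nu (w : Equiv.Perm (Fin n)) : (eta w : ℤ) + 1 ≤ nu w := by
  classical
  induction w using perm_lex_induction with
  | _ w ih =>
    by_cases hne : w = Fin.revPerm
    · have h := eta_eq_zero_of_avoids132 (w := w) (by rw [hne]; exact avoids132_revPerm)
      rw [nu_eq_one_of_eta_eq_zero h, h]
      simp
    · obtain ⟨i, j, hf⟩ := exists_isFirstAscent w hne
      have hterm : ∀ b ∈ Finset.univ.filter (IsCoverPair w i),
          (eta (w * Equiv.swap i b) : ℤ) + 1 ≤ nu (w * Equiv.swap i b) := by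
        intro b hb
        obtain ⟨h1, h2, -⟩ := (Finset.mem_filter.1 hb).2
        exact ih i b h1 h2
      have hnn : ∀ b ∈ Finset.univ.filter (IsCoverPair w i), 0 ≤ nu (w * Equiv.swap i b) :=
        fun b hb => by have := hterm b hb; omega
      have hj : j ∈ Finset.univ.filter (IsCoverPair w i) := by
        simpa using isCoverPair_of_val_succ hf.1 hf.2.1
      have hη := hf.eta_eq
      have hjle := hterm j hj
      rcases (gapPositions w i j).eq_empty_or_nonempty with he | he
      · have := Finset.single_le_sum hnn hj
        rw [← hf.nu_eq_sum] at this
        rw [he, Finset.card_empty] at hη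
        omega
      -- The cover at `j` contributes at least `η_{w s_i} + 1` and the one at `b` at least the size
      -- of the gap; together these make `η_w + 1`.
      · obtain ⟨b, hb, hc, hmin⟩ := exists_min_gapPosition hf.1 he
        have hble := hterm b (by simpa using hc)
        have hcard := card_gapPositions_le hf.1 hb hmin
        have hjb : j ≠ b := (mem_gapPositions.1 hb).1.ne
        have hsub : ({j, b} : Finset (Fin n)) ⊆ Finset.univ.filter (IsCoverPair w i) := by
          intro c hc'
          rcases Finset.mem_insert.1 hc' with rfl | hc'
          · exact hj
          · rw [Finset.mem_singleton.1 hc']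
            simpa using hc
        have := Finset.sum_le_sum_of_subset_of_nonneg hsub fun c hc _ => hnn c hc
        rw [← hf.nu_eq_sum, Finset.sum_pair hjb] at this
        omega

/-- A 132 pattern `(p, q, r)` after the swap would give a second one in `w`, either at the same
positions or with one of them replaced by `i` or `b`, unless it needs an entry left of `i` that is
too small. -/
theorem avoids132_mul_swap_of_unique {w : Equiv.Perm (Fin n)} {i j b : Fin n}
    (hf : IsFirstAscent w i j)
    (hb : b ∈ gapPositions w i j) (hmin : ∀ c, i < c → w i < w c → w b ≤ w c)
    (huniq : ∀ p q r, p < q → q < r → w p < w r → w r < w q → p = i ∧ q = j ∧ r = b) :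
    Avoids132 (w * Equiv.swap i b) := by
  obtain ⟨hij, hw, hf⟩ := hf
  obtain ⟨hjb, hib, hbj⟩ := mem_gapPositions.1 hb
  have hji : i < j := by rw [Fin.lt_def]; omega
  -- A smaller entry at `a` would make `(a, j, b)` a second pattern.
  have hleft : ∀ a, a < i → w b < w a := by
    intro a ha
    by_contra h
    have hne : w a ≠ w b := fun h => by have := w.injective h; grind
    have := huniq a j b (ha.trans hji) hjb (lt_of_le_of_ne (not_lt.1 h) hne) hbj
    exact ha.ne this.1
  intro p q r hpq hqr
  simp only [Equiv.Perm.mul_apply]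
  have hs : ∀ c, Equiv.swap i b c = if c = i then b else if c = b then i else c :=
    fun c => Equiv.swap_apply_def i b c
  have u1 := huniq p q r hpq hqr
  have u2 := huniq i q r
  have u3 := huniq p b r
  have l1 := hleft p
  have f1 := hf p
  have m1 := hmin q
  have m2 := hmin p
  have m3 := hmin r
  have inj : ∀ c, w c = w b → c = b := fun c h => w.injective h
  have i1 := inj p
  have i2 := inj q
  have i3 := inj r
  rw [hs, hs, hs]
  clear huniq hleft hf hmin hs inj hb
  intro h1 h2
  split_ifs at h1 h2 <;> grind

theorem nu_eq_two_of_eta_eq_one (w : Equiv.Perm (Fin n)) (hη : eta w = 1) : nu w = 2 := by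
  classical
  induction w using perm_lex_induction with
  | _ w ih =>
    have hne : w ≠ Fin.revPerm := by
      rintro rfl
      rw [eta_eq_zero_of_avoids132 avoids132_revPerm] at hη
      omega
    obtain ⟨i, j, hf⟩ := exists_isFirstAscent w hne
    have hlt : i < j := by have := hf.1; rw [Fin.lt_def]; omega
    have hη' := hf.eta_eq
    have hcj := isCoverPair_of_val_succ hf.1 hf.2.1
    have hcov : ∀ b, IsCoverPair w i b → b ≠ j → b ∈ gapPositions w i j := by
      intro b ⟨h1, h2, h3⟩ hbj
      have hjb : j < b := by
        have := hf.1; rw [Ne, Fin.ext_iff] at hbj; rw [Fin.lt_def] at *; omega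
      refine mem_gapPositions.2 ⟨hjb, h2, ?_⟩
      have := h3 j hlt hjb
      exact lt_of_le_of_ne (not_lt.1 fun h => this ⟨hf.2.1, h⟩) fun h => hbj (w.injective h)
    rcases (gapPositions w i j).eq_empty_or_nonempty with he | he
    · rw [he, Finset.card_empty, add_zero] at hη'
      have : Finset.univ.filter (IsCoverPair w i) = {j} := by
        ext b
        simp only [Finset.mem_filter, Finset.mem_univ, true_and, Finset.mem_singleton]
        refine ⟨fun h => ?_, by rintro rfl; exact hcj⟩
        by_contra hb
        simpa [he] using hcov b h hb
      rw [hf.nu_eq_sum, this, Finset.sum_singleton]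
      exact ih i j hlt hf.2.1 (hη'.symm.trans hη)
    · obtain ⟨b, hb, hc, hmin⟩ := exists_min_gapPosition hf.1 he
      obtain ⟨hjb, hib, hbj⟩ := mem_gapPositions.1 hb
      have hpos := he.card_pos
      have huniq : ∀ p q r, p < q → q < r → w p < w r → w r < w q → p = i ∧ q = j ∧ r = b := by
        intro p q r h1 h2 h3 h4
        have := Finset.card_le_one.1 hη.le _ (mem_patterns132.2 ⟨h1, h2, h3, h4⟩) _
          (mem_patterns132.2 ⟨hlt, hjb, hib, hbj⟩)
        simpa using this
      -- A cover other than `j` lies in the gap, and a second gap position would be a second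
      -- pattern.
      have : Finset.univ.filter (IsCoverPair w i) = {j, b} := by
        ext c
        simp only [Finset.mem_filter, Finset.mem_univ, true_and, Finset.mem_insert,
          Finset.mem_singleton]
        constructor
        · intro h
          by_contra! hcb
          obtain ⟨h1, h2, h3⟩ := mem_gapPositions.1 (hcov c h hcb.1)
          exact hcb.2 (huniq i j c hlt h1 h2 h3).2.2
        · rintro (rfl | rfl)
          · exact hcj
          · exact hc
      rw [hf.nu_eq_sum, this, Finset.sum_pair hjb.ne,
        nu_eq_one_of_eta_eq_zero (w := w * Equiv.swap i j) (by omega),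
        nu_eq_one_of_eta_eq_zero
          (eta_eq_zero_of_avoids132 (avoids132_mul_swap_of_unique hf hb hmin huniq))]
      norm_num

end SchubertPoly

theorem corollary2 (n : ℕ) (w : Equiv.Perm (Fin n)) :
    SchubertPoly.nu w = 2 ↔ SchubertPoly.eta w = 1 := by
  refine ⟨fun h => ?_, SchubertPoly.nu_eq_two_of_eta_eq_one w⟩
  have h1 := SchubertPoly.eta_add_one_le_nu w
  by_contra hne
  have h0 := SchubertPoly.nu_eq_one_of_eta_eq_zero (w := w) (by omega)
  omega
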